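/- **Conventions.** Let $X$ be a set with an extended metric $d$ with a point at infinity $*_X$: $d(x,*_X)=\infty$ for all $x\neq *_X$, $d(*_X,*_X)=0$, and $d$ restricted to the set of finite points $X\setminus\{*_X\}$ is a metric, which is assumed to be unbounded. The topology of $X$ is generated by the balls $B(x,r)$ and the sets $\{y : d(x,y)>r\}\ni *_X$ ($x$ finite, $0<r<\infty$). Fix a finite point $o\in X$ (the origin) and write $|x|=d(o,x)$. The same conventions are used for $(Y,o',*_Y)$. - An *admissible gauge* is a nondecreasing function $u:[0,\infty)\to\mathbb R$ with $\limsup_{r\to\infty}u(r)/r=0$. Finite points $x,y$ are *separated by $u$* if $d(x,y)>u(|x|+|y|)$; every finite point is separated from $*_X$. - For $x\ne w$, $y\neq z$ the *cross ratio* is $[x,y,z,w]=\frac{d(x,z)\,d(y,w)}{d(x,w)\,d(y,z)}$, where factors containing the point at infinity are omitted; it is $0$ if $x=z$ or $y=w$. For image points, the value is $\infty$ if $x=w$ or $y=z$, unless $x=z$ or $y=w$ (in which case it is $0$). - A map $f:X\to Y$ with $f(o)=o'$ and $f(*_X)=*_Y$ is an *AM-map* (asymptotic-Möbius map at infinity)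 if there are an admissible gauge $u$ and a homeomorphism $\eta:[0,\infty)\to[0,\infty)$ such that $[f(x),f(y),f(z),f(w)]<\eta([x,y,z,w])$ for all $x,y,z,w\in X$ that are pairwise separated by $u$ (and with $x\neq w$, $y\ne z$). It is *regular* if it is continuous at $*_X$ and for every neighbourhood $V$ of $*_X$ there is a neighbourhood $U$ of $*_Y$ with $f^{-1}(U)\subset V$. - $(X,o,*_X)$ is *asymptotically chained* if there is an admissible gauge $v$ such that any two finite points $x,y$ are joined by a finite chain $x=x_1,\dots,x_{k+1}=y$ of finite points with $d(x_i,x_{i+1})<v(|x|+|y|)$ for all $i$. - For a finite point $q\in X$, a nonprincipal ultrafilter $\omega$ on $\mathbb N$ and reals $\lambda_n$ with $\lim_\omega\lambda_n=\infty$, the *asymptotic cone* $\operatorname{Cone}^\omega_{\lambda_n}(X,q)$ is the metric space (of finite points) consisting of the sequences $(x_n)$ of finite points of $X$ with $\lim_\omega d(q,x_n)/\lambda_n<\infty$, with the distance $\lim_\omega d(x_n,y_n)/\lambda_n$, where sequences at distance $0$ are identified. - The *covering dimension* of a space is the least $n\in\mathbb N$ such that every finite open cover has an open refinement that is a cover and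 in which every point lies in at most $n+1$ members ($\infty$ if there is no such $n$). The *geometric dimension* of a metric space is the supremum of the covering dimensions of its compact subsets. If all asymptotic cones of $X$ are $\operatorname{CAT}(0)$-spaces, the *telescopic dimension* $\operatorname{tele-dim}(X)\in\mathbb N\cup\{\infty\}$ is the supremum of the geometric dimensions of all asymptotic cones of $X$. **Theorem.** Let $X$ and $Y$ be extended metric spaces with points at infinity $*_X$ and $*_Y$, and let $o\in X$, $o'\in Y$ be finite points. Suppose that $(X,o,*_X)$ is asymptotically chained and that all asymptotic cones of $X$ and of $Y$ are $\operatorname{CAT}(0)$-spaces. If there exists a regular AM-map $f:(X,o,*_X)\to(Y,o',*_Y)$, then $$\operatorname{tele-dim}(X)\le\operatorname{tele-dim}(Y).$$ -/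

import Mathlib

open Filter Topology Set
open scoped NNReal ENNReal

universe u v

/-! ### Extended metric spaces with a point at infinity -/

/-- A set `X` with an extended metric that has a point at infinity `infPt`: all other points are
at distance `∞` from it, and the distance restricted to the other (finite) points is a metric.
As usual for spaces with a point at infinity, the metric space of finite points is unbounded. -/
class ExtendedMetricSpace (X : Type u) where
  xdist : X → X → ℝ≥0∞
  infPt : X
  xdist_self : ∀ x, xdist x x = 0
  xdist_comm : ∀ x y, xdist x y = xdist y x
  xdist_infPt : ∀ x, x ≠ infPt → xdist x infPt = ∞
  xdist_ne_top : ∀ x y, x ≠ infPt → y ≠ infPt → xdist x y ≠ ∞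
  eq_of_xdist_eq_zero : ∀ x y, x ≠ infPt → y ≠ infPt → xdist x y = 0 → x = y
  xdist_triangle : ∀ x y z, x ≠ infPt → y ≠ infPt → z ≠ infPt →
    xdist x z ≤ xdist x y + xdist y z
  unbounded : ∀ x, x ≠ infPt → ∀ R : ℝ≥0, ∃ y, y ≠ infPt ∧ (R : ℝ≥0∞) < xdist x y

open ExtendedMetricSpace

/-- The finite points of an extended metric space. -/
def FinPt (X : Type u) [ExtendedMetricSpace X] : Type u := {x : X // x ≠ infPt}

/-- The metric on the finite points. -/
noncomputable instance FinPt.metricSpace (X : Type u) [ExtendedMetricSpace X] :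
    MetricSpace (FinPt X) where
  dist x y := (xdist x.1 y.1).toReal
  dist_self x := by simp [xdist_self]
  dist_comm x y := by rw [xdist_comm]
  dist_triangle x y z := by
    rw [← ENNReal.toReal_add (xdist_ne_top _ _ x.2 y.2) (xdist_ne_top _ _ y.2 z.2)]
    exact ENNReal.toReal_mono
      (ENNReal.add_ne_top.2 ⟨xdist_ne_top _ _ x.2 y.2, xdist_ne_top _ _ y.2 z.2⟩)
      (xdist_triangle _ _ _ x.2 y.2 z.2)
  eq_of_dist_eq_zero {x y} h := by
    rcases (ENNReal.toReal_eq_zero_iff _).1 h with h | h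
    · exact Subtype.ext (eq_of_xdist_eq_zero _ _ x.2 y.2 h)
    · exact absurd h (xdist_ne_top _ _ x.2 y.2)

/-- The extended metric topology: it is generated by the open balls `B(x, r)` and by the complements
`U(x, r)` (which contain the point at infinity) of closed balls, for finite `x` and `r > 0`. -/
abbrev extendedMetricTopology (X : Type u) [ExtendedMetricSpace X] : TopologicalSpace X :=
  TopologicalSpace.generateFrom
    ({s | ∃ (x : FinPt X) (r : ℝ≥0), 0 < r ∧ s = {y | xdist x.1 y < r}} ∪
     {s | ∃ (x : FinPt X) (r : ℝ≥0), 0 < r ∧ s = {y | (r : ℝ≥0∞) < xdist x.1 y}})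

section CrossRatio

variable {X : Type u} [ExtendedMetricSpace X]

open Classical in
/-- The factor `d(x, y)` of a cross ratio; it is omitted if it contains the point at infinity. -/
noncomputable def crossFactor (x y : X) : ℝ≥0∞ :=
  if x = infPt ∨ y = infPt then 1 else xdist x y

open Classical in
/-- The cross ratio `[x, y, z, w] = d(x, z) d(y, w) / (d(x, w) d(y, z))`, with values in `[0, ∞]`.
It is a number in `[0, ∞)` if `x ≠ w` and `y ≠ z`; it is `0` if `x = z` or `y = w`, and otherwise
it is `∞` if `x = w` or `y = z`. -/
noncomputable def crossRatio (x y z w : X) : ℝ≥0∞ :=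
  if x = z ∨ y = w then 0
  else if x = w ∨ y = z then ∞
  else (crossFactor x z * crossFactor y w) / (crossFactor x w * crossFactor y z)

end CrossRatio

/-! ### Gauges, AM-maps, asymptotic chains -/

/-- Admissible gauges: nondecreasing functions of sublinear growth. (A nondecreasing function on
`[0, ∞)` is bounded below, so `limsup u(r)/r = 0` says that `u(r)/r` tends to `0`.) -/
structure IsAdmissibleGauge (u : ℝ≥0 → ℝ) : Prop where
  monotone : Monotone u
  sublinear : Tendsto (fun r : ℝ≥0 => u r / (r : ℝ)) atTop (𝓝 0)

section AM

variable {X : Type u} [ExtendedMetricSpace X] {Y : Type v} [ExtendedMetricSpace Y]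

/-- `x` and `y` are separated by `u` at the point at infinity, with respect to the origin `q`:
`d(x, y) > u(d(x, q) + d(q, y))` if both are finite; moreover every finite point is separated from
the point at infinity. -/
def Separated (u : ℝ≥0 → ℝ) (q : FinPt X) (x y : X) : Prop :=
  (x ≠ infPt ∧ y ≠ infPt ∧
    u ((xdist x q.1).toNNReal + (xdist q.1 y).toNNReal) < (xdist x y).toReal) ∨
  (x ≠ infPt ∧ y = infPt) ∨ (x = infPt ∧ y ≠ infPt)

/-- The four points are pairwise separated by `u` at infinity. -/
def PairwiseSeparated (u : ℝ≥0 → ℝ) (q : FinPt X) (x y z w : X) : Prop :=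
  Separated u q x y ∧ Separated u q x z ∧ Separated u q x w ∧
  Separated u q y z ∧ Separated u q y w ∧ Separated u q z w

/-- `f : (X, q, *_X) → (Y, q', *_Y)` is an asymptotic-Möbius map at infinity: a map of doubly
pointed spaces, for which there are an admissible gauge `u` and a homeomorphism `η` of `[0, ∞)` such
that `[f x, f y, f z, f w] < η [x, y, z, w]` for every cross ratio `[x, y, z, w]` of points that are
pairwise separated by `u`. -/
structure IsAMMap (f : X → Y) (q : FinPt X) (q' : FinPt Y) : Prop where
  map_origin : f q.1 = q'.1
  map_infPt : f infPt = infPt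
  cross_ratio : ∃ (u : ℝ≥0 → ℝ) (η : ℝ≥0 ≃ₜ ℝ≥0), IsAdmissibleGauge u ∧
    ∀ x y z w : X, PairwiseSeparated u q x y z w → x ≠ w → y ≠ z →
      crossRatio (f x) (f y) (f z) (f w) < η (crossRatio x y z w).toNNReal

/-- Regular AM-maps at infinity: `f` is continuous at the point at infinity, and preimages of small
neighbourhoods of the point at infinity are contained in small neighbourhoods of it. -/
structure IsRegularAMMap (f : X → Y) (q : FinPt X) (q' : FinPt Y) : Prop
    extends IsAMMap f q q' where
  continuousAt : @ContinuousAt X Y (extendedMetricTopology X) (extendedMetricTopology Y) f infPt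
  preimage_subset : ∀ V ∈ @nhds X (extendedMetricTopology X) infPt,
    ∃ U ∈ @nhds Y (extendedMetricTopology Y) infPt, f ⁻¹' U ⊆ V

/-- `(X, q, *_X)` is asymptotically chained: for some admissible gauge `v`, any finite points `x`
and `y` are joined by a finite chain of finite points with steps shorter than `v(|x| + |y|)`. -/
def AsymptoticallyChained (q : FinPt X) : Prop :=
  ∃ v : ℝ≥0 → ℝ, IsAdmissibleGauge v ∧ ∀ x y : FinPt X,
    ∃ (k : ℕ) (c : ℕ → FinPt X), c 0 = x ∧ c k = y ∧
      ∀ i < k, dist (c i) (c (i + 1)) < v (nndist q x + nndist q y)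

end AM

/-! ### Asymptotic cones -/

section Cone

variable {M : Type u} [MetricSpace M]

/-- The sequences that represent the finite points of the asymptotic cone of `M` with origin `q`,
ultrafilter `ω` and scales `r n → ∞`: those with `d(q, x n) / r n` bounded `ω`-almost surely. -/
def ConeSeq (q : M) (ω : Ultrafilter ℕ) (r : ℕ → ℝ) (_hr : Tendsto r ω atTop) : Type u :=
  {x : ℕ → M // ∃ C : ℝ, ∀ᶠ n in (ω : Filter ℕ), dist q (x n) / r n ≤ C}

variable {q : M} {ω : Ultrafilter ℕ} {r : ℕ → ℝ} {hr : Tendsto r ω atTop}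

/-- The distance `lim_ω d(x n, y n) / r n`. -/
noncomputable def coneDist (x y : ConeSeq q ω r hr) : ℝ :=
  limUnder (ω : Filter ℕ) (fun n => dist (x.1 n) (y.1 n) / r n)

/-- The limit that defines `coneDist` exists. -/
theorem tendsto_coneDist (x y : ConeSeq q ω r hr) :
    Tendsto (fun n => dist (x.1 n) (y.1 n) / r n) ω (𝓝 (coneDist x y)) := by
  obtain ⟨C, hC⟩ := x.2
  obtain ⟨D, hD⟩ := y.2
  have hmem : ∀ᶠ n in (ω : Filter ℕ), dist (x.1 n) (y.1 n) / r n ∈ Icc 0 (C + D) := by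
    filter_upwards [hC, hD, hr.eventually_gt_atTop 0] with n h1 h2 h3
    refine ⟨by positivity, ?_⟩
    calc dist (x.1 n) (y.1 n) / r n ≤ (dist q (x.1 n) + dist q (y.1 n)) / r n := by
          gcongr
          exact dist_triangle_left _ _ _
      _ = dist q (x.1 n) / r n + dist q (y.1 n) / r n := add_div _ _ _
      _ ≤ C + D := add_le_add h1 h2
  obtain ⟨l, -, hl⟩ := isCompact_Icc.ultrafilter_le_nhds
    (ω.map (fun n => dist (x.1 n) (y.1 n) / r n))
    (by rw [le_principal_iff]; exact hmem)
  exact tendsto_nhds_limUnder ⟨l, hl⟩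

/-- `coneDist` is a pseudometric. -/
noncomputable instance ConeSeq.pseudoMetricSpace : PseudoMetricSpace (ConeSeq q ω r hr) where
  dist := coneDist
  dist_self x := by
    refine tendsto_nhds_unique (tendsto_coneDist x x) ?_
    simp
  dist_comm x y := by
    refine tendsto_nhds_unique (tendsto_coneDist x y) ?_
    simpa only [dist_comm] using tendsto_coneDist y x
  dist_triangle x y z := by
    refine le_of_tendsto_of_tendsto (tendsto_coneDist x z)
      ((tendsto_coneDist x y).add (tendsto_coneDist y z)) ?_
    filter_upwards [hr.eventually_gt_atTop 0] with n h
    rw [← add_div]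
    gcongr
    exact dist_triangle _ _ _

end Cone

/-- The (metric space of finite points of the) asymptotic cone of `X` with origin `q`, ultrafilter
`ω` and scales `r n`: sequences in `X`, two of them being identified if their distance
`lim_ω d(x n, y n) / r n` vanishes. -/
abbrev AsymptoticCone {X : Type u} [ExtendedMetricSpace X] (q : FinPt X) (ω : Ultrafilter ℕ)
    (r : ℕ → ℝ) (hr : Tendsto r ω atTop) : Type u :=
  SeparationQuotient (ConeSeq q ω r hr)

/-! ### CAT(0) spaces -/

/-- `c`, restricted to `[0, d(x, y)]`, is a geodesic from `x` to `y`. -/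
structure IsGeodesicFromTo {M : Type u} [MetricSpace M] (c : ℝ → M) (x y : M) : Prop where
  start : c 0 = x
  finish : c (dist x y) = y
  isometry : ∀ s ∈ Icc 0 (dist x y), ∀ t ∈ Icc 0 (dist x y), dist (c s) (c t) = |s - t|

/-- CAT(0) spaces: geodesic metric spaces whose geodesic triangles are not thicker than their
comparison triangles in the Euclidean plane. (Two sides of a triangle have a common vertex, which
is called `x` here.) -/
structure IsCAT0 (M : Type u) [MetricSpace M] : Prop where
  geodesic : ∀ x y : M, ∃ c : ℝ → M, IsGeodesicFromTo c x y
  comparison : ∀ (x y z : M) (c c' : ℝ → M), IsGeodesicFromTo c x y → IsGeodesicFromTo c' x z →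
    ∀ x₀ y₀ z₀ : EuclideanSpace ℝ (Fin 2),
      dist x₀ y₀ = dist x y → dist x₀ z₀ = dist x z → dist y₀ z₀ = dist y z →
      ∀ s ∈ Icc 0 (dist x y), ∀ t ∈ Icc 0 (dist x z),
        ∀ p₀ ∈ segment ℝ x₀ y₀, ∀ q₀ ∈ segment ℝ x₀ z₀, dist x₀ p₀ = s → dist x₀ q₀ = t →
          dist (c s) (c' t) ≤ dist p₀ q₀

/-- All asymptotic cones of `X` are CAT(0) spaces. -/
def AllAsymptoticConesCAT0 (X : Type u) [ExtendedMetricSpace X] : Prop :=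
  ∀ (q : FinPt X) (ω : Ultrafilter ℕ), (ω : Filter ℕ) ≤ cofinite →
    ∀ (r : ℕ → ℝ) (hr : Tendsto r ω atTop), IsCAT0 (AsymptoticCone q ω r hr)

/-! ### Dimensions -/

/-- Every finite open cover of `T` has an open refinement that covers `T` and such that every point
lies in at most `n + 1` of its members. -/
def CoveringDimLE (T : Type u) [TopologicalSpace T] (n : ℕ) : Prop :=
  ∀ 𝒱 : Set (Set T), 𝒱.Finite → (∀ V ∈ 𝒱, IsOpen V) → ⋃₀ 𝒱 = univ →
    ∃ 𝒰 : Set (Set T), (∀ U ∈ 𝒰, IsOpen U) ∧ ⋃₀ 𝒰 = univ ∧ (∀ U ∈ 𝒰, ∃ V ∈ 𝒱, U ⊆ V) ∧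
      ∀ x : T, {U ∈ 𝒰 | x ∈ U}.encard ≤ n + 1

/-- The covering dimension: the least `n` as above, or `∞` if there is none. -/
noncomputable def coveringDim (T : Type u) [TopologicalSpace T] : ℕ∞ :=
  ⨅ (n : ℕ) (_ : CoveringDimLE T n), (n : ℕ∞)

/-- The geometric dimension: the supremum of the covering dimensions of the compact subsets. -/
noncomputable def geomDim (M : Type u) [MetricSpace M] : ℕ∞ :=
  ⨆ (K : Set M) (_ : IsCompact K), coveringDim K

/-- The telescopic dimension: the supremum of the geometric dimensions of all asymptotic cones, so
it is at most `n` if and only if every asymptotic cone has geometric dimension at most `n`. -/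
noncomputable def teleDim (X : Type u) [ExtendedMetricSpace X] : ℕ∞ :=
  ⨆ (q : FinPt X) (ω : Ultrafilter ℕ) (_ : (ω : Filter ℕ) ≤ cofinite)
    (r : ℕ → ℝ) (hr : Tendsto r ω atTop), geomDim (AsymptoticCone q ω r hr)

/-!
Putting the fourth point of the cross ratio at infinity, the AM-inequality says that `f` is
quasi-symmetric on triples of finite points separated by a sublinear gauge. Sequences representing
distinct points of an asymptotic cone are eventually separated by every such gauge, so, after one
representative per point has been chosen and the target has been rescaled by the distances
`d(f o, f (p n))` for a point `p` of the cone other than the origin, `f` induces a genuinely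
quasi-symmetric map into an asymptotic cone of `Y`. A nonconstant quasi-symmetric map is continuous
and injective, hence a homeomorphism from every compact subset onto its image, so it does not
decrease the geometric dimension.
-/

open Bornology (cobounded)

theorem homeomorph_map_bot {α β : Type*} [ConditionallyCompleteLinearOrder α] [DenselyOrdered α]
    [OrderBot α] [TopologicalSpace α] [OrderTopology α] [LinearOrder β] [OrderBot β] [NoTopOrder β]
    [TopologicalSpace β] [OrderClosedTopology β] (e : α ≃ₜ β) : e ⊥ = ⊥ := by
  rcases e.continuous.strictMono_of_inj e.injective with hmono | hanti
  · obtain ⟨a, ha⟩ := e.surjective ⊥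
    exact le_bot_iff.1 ((hmono.monotone bot_le).trans_eq ha)
  · refine (not_isTop (e ⊥) fun b => ?_).elim
    obtain ⟨a, rfl⟩ := e.surjective b
    exact hanti.antitone bot_le

/-! ### Dimension -/

theorem CoveringDimLE.of_homeomorph {S : Type u} {T : Type v} [TopologicalSpace S]
    [TopologicalSpace T] (e : S ≃ₜ T) {n : ℕ} (h : CoveringDimLE T n) : CoveringDimLE S n := by
  intro 𝒱 hfinite hopen hcover
  have hcover' : ⋃₀ ((e.symm ⁻¹' ·) '' 𝒱) = univ := by
    rw [sUnion_image, ← preimage_iUnion₂, ← sUnion_eq_biUnion, hcover, preimage_univ]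
  obtain ⟨𝒰, hopenU, hcoverU, hrefine, horder⟩ := h ((e.symm ⁻¹' ·) '' 𝒱) (hfinite.image _)
    (forall_mem_image.2 fun V hV => (hopen V hV).preimage e.symm.continuous) hcover'
  refine ⟨(e ⁻¹' ·) '' 𝒰, forall_mem_image.2 fun U hU => (hopenU U hU).preimage e.continuous,
    ?_, forall_mem_image.2 fun U hU => ?_, fun x => ?_⟩
  · rw [sUnion_image, ← preimage_iUnion₂, ← sUnion_eq_biUnion, hcoverU, preimage_univ]
  · obtain ⟨_, ⟨V, hV, rfl⟩, hUV⟩ := hrefine U hU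
    exact ⟨V, hV, fun x hx => by simpa using hUV hx⟩
  · have hsub : {U ∈ (e ⁻¹' ·) '' 𝒰 | x ∈ U} ⊆ (e ⁻¹' ·) '' {U ∈ 𝒰 | e x ∈ U} := by
      rintro _ ⟨⟨U, hU, rfl⟩, hx⟩
      exact ⟨U, ⟨hU, hx⟩, rfl⟩
    exact (encard_le_encard hsub).trans ((encard_image_le _ _).trans (horder (e x)))

theorem coveringDim_le_of_homeomorph {S : Type u} {T : Type v} [TopologicalSpace S]
    [TopologicalSpace T] (e : S ≃ₜ T) : coveringDim S ≤ coveringDim T :=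
  le_iInf₂ fun n hn => iInf₂_le n (hn.of_homeomorph e)

theorem geomDim_le_of_continuous_of_injective {M : Type u} {N : Type v} [MetricSpace M]
    [MetricSpace N] {F : M → N} (hF : Continuous F) (hinj : Function.Injective F) :
    geomDim M ≤ geomDim N := by
  refine iSup₂_le fun K hK => ?_
  have : CompactSpace K := isCompact_iff_compactSpace.1 hK
  let e : K ≃ₜ F '' K := Continuous.homeoOfEquivCompactToT2 (f := Equiv.Set.image F K hinj)
    ((hF.comp continuous_subtype_val).subtype_mk _)
  exact (coveringDim_le_of_homeomorph e).trans (le_iSup₂_of_le (F '' K) (hK.image hF) le_rfl)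

theorem geomDim_asymptoticCone_le_teleDim {X : Type u} [ExtendedMetricSpace X] (q : FinPt X)
    {ω : Ultrafilter ℕ} (hω : (ω : Filter ℕ) ≤ cofinite) {r : ℕ → ℝ} (hr : Tendsto r ω atTop) :
    geomDim (AsymptoticCone q ω r hr) ≤ teleDim X :=
  le_iSup_of_le q <| le_iSup_of_le ω <| le_iSup_of_le hω <| le_iSup_of_le r <|
    le_iSup_of_le hr le_rfl

/-! ### Quasi-symmetric maps -/

section QuasiSymmetric

variable {M : Type u} {N : Type v} [MetricSpace M] [MetricSpace N]

/-- `F` is quasi-symmetric with control function `η`: ratios of distances to a common point `z` are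
distorted at most by `η`. The inequality is written without a quotient on the left, so constant maps
qualify; the case `x = y`, which would force `1 ≤ η 1`, is left out. -/
def QuasiSymmetric (η : ℝ≥0 → ℝ≥0) (F : M → N) : Prop :=
  ∀ x y z : M, x ≠ y → y ≠ z →
    dist (F x) (F z) ≤ η (nndist x z / nndist y z) * dist (F y) (F z)

variable {η : ℝ≥0 → ℝ≥0} {F : M → N}

theorem QuasiSymmetric.injective (hF : QuasiSymmetric η F) {p q : M} (hpq : F p ≠ F q) :
    Function.Injective F := by
  intro x y hxy
  by_contra hne
  have hconst : ∀ z, F z = F y := by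
    intro z
    rcases eq_or_ne z x with rfl | hzx
    · exact hxy
    · simpa [hxy] using hF z x y hzx hne
  exact hpq ((hconst p).trans (hconst q).symm)

theorem QuasiSymmetric.continuous (hF : QuasiSymmetric η F) (hη : Tendsto η (𝓝 0) (𝓝 0)) :
    Continuous F := by
  rcases subsingleton_or_nontrivial M with _ | _
  · exact continuous_of_discreteTopology
  refine continuous_iff_continuousAt.2 fun z => ?_
  obtain ⟨y, hyz⟩ := exists_ne z
  have hratio : Tendsto (fun x => nndist x z / nndist y z) (𝓝 z) (𝓝 0) := by
    have hcont : Continuous fun x => nndist x z / nndist y z := by fun_prop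
    simpa using hcont.tendsto z
  have hbound : Tendsto (fun x => (η (nndist x z / nndist y z) : ℝ) * dist (F y) (F z)) (𝓝 z)
      (𝓝 0) := by
    simpa using (NNReal.tendsto_coe.2 (hη.comp hratio)).mul_const (dist (F y) (F z))
  rw [ContinuousAt, tendsto_iff_dist_tendsto_zero]
  refine squeeze_zero' (Eventually.of_forall fun _ => dist_nonneg) ?_ hbound
  filter_upwards [isOpen_ne.mem_nhds hyz.symm] with x hxy
  exact hF x y z hxy hyz

/-- `g` is quasi-symmetric with control function `η` on the triples of points that are pairwise
separated by the gauge `u` with respect to the origin `o`. Gauges may take negative values, so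
separation does not imply `b ≠ c`. -/
def QuasiSymmetricUpTo (u : ℝ≥0 → ℝ) (η : ℝ≥0 → ℝ≥0) (o : M) (g : M → N) : Prop :=
  ∀ a b c : M, b ≠ c → u (nndist o a + nndist o b) < dist a b →
    u (nndist o a + nndist o c) < dist a c → u (nndist o b + nndist o c) < dist b c →
    dist (g a) (g c) ≤ η (nndist a c / nndist b c) * dist (g b) (g c)

end QuasiSymmetric

/-! ### AM-maps on the finite points -/

section ExtendedMetric

variable {X : Type u} [ExtendedMetricSpace X]

theorem FinPt.xdist_eq_nndist (x y : FinPt X) : xdist x.1 y.1 = nndist x y :=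
  (ENNReal.coe_toNNReal (xdist_ne_top _ _ x.2 y.2)).symm

theorem separated_of_gauge_lt_dist {u : ℝ≥0 → ℝ} {o a b : FinPt X}
    (h : u (nndist o a + nndist o b) < dist a b) : Separated u o a.1 b.1 := by
  refine Or.inl ⟨a.2, b.2, ?_⟩
  rw [xdist_comm a.1 o.1]
  exact h

theorem crossRatio_infPt {a b c : FinPt X} (hbc : b ≠ c) :
    crossRatio a.1 b.1 c.1 infPt = (nndist a c / nndist b c : ℝ≥0) := by
  rcases eq_or_ne a c with rfl | hac
  · simp [crossRatio]
  · rw [ENNReal.coe_div (by simpa using hbc)]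
    simp [crossRatio, crossFactor, Subtype.coe_ne_coe.2 hac, Subtype.coe_ne_coe.2 hbc, a.2, b.2,
      c.2, FinPt.xdist_eq_nndist]

theorem dist_le_mul_of_crossRatio_infPt_lt {a b c : FinPt X} {t : ℝ≥0}
    (h : crossRatio a.1 b.1 c.1 infPt < t) : dist a c ≤ t * dist b c := by
  rcases eq_or_ne b c with rfl | hbc
  · have hab : a = b := by
      by_contra hab
      simp [crossRatio, Subtype.coe_ne_coe.2 hab, b.2] at h
    simp [hab]
  · rw [crossRatio_infPt hbc, ENNReal.coe_lt_coe, ← NNReal.coe_lt_coe, NNReal.coe_div,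
      coe_nndist, coe_nndist, div_lt_iff₀ (dist_pos.2 hbc)] at h
    exact h.le

attribute [local instance] extendedMetricTopology

theorem setOf_lt_xdist_mem_nhds_infPt (x : FinPt X) {r : ℝ≥0} (hr : 0 < r) :
    {y : X | r < xdist x.1 y} ∈ 𝓝 (infPt : X) := by
  refine IsOpen.mem_nhds (TopologicalSpace.isOpen_generateFrom_of_mem (Or.inr ⟨x, r, hr, rfl⟩)) ?_
  simp [xdist_infPt x.1 x.2]

theorem FinPt.comap_val_nhds_infPt :
    comap (fun x : FinPt X => x.1) (𝓝 infPt) = cobounded (FinPt X) := by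
  apply le_antisymm
  · rcases isEmpty_or_nonempty (FinPt X) with _ | ⟨⟨o⟩⟩
    · simp [filter_eq_bot_of_isEmpty]
    · refine (Metric.hasBasis_cobounded_compl_closedBall o).ge_iff.2 fun r _ => ?_
      refine ⟨_, setOf_lt_xdist_mem_nhds_infPt o (r := r.toNNReal + 1) (by positivity), ?_⟩
      intro x hx
      rw [mem_preimage, mem_ofPred_eq, FinPt.xdist_eq_nndist, ENNReal.coe_lt_coe,
        ← NNReal.coe_lt_coe, NNReal.coe_add, NNReal.coe_one, coe_nndist, dist_comm] at hx
      simpa using (Real.le_coe_toNNReal r).trans_lt ((lt_add_one _).trans hx)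
  · rw [← tendsto_iff_comap, TopologicalSpace.tendsto_nhds_generateFrom_iff]
    rintro s (⟨x, r, -, rfl⟩ | ⟨x, r, -, rfl⟩) hs
    · simp [xdist_infPt x.1 x.2] at hs
    · filter_upwards [(Metric.tendsto_dist_left_cobounded_atTop x).eventually_gt_atTop (r : ℝ)]
        with y hy
      rw [mem_preimage, mem_ofPred_eq, FinPt.xdist_eq_nndist, ENNReal.coe_lt_coe]
      exact_mod_cast hy

variable {Y : Type v} [ExtendedMetricSpace Y] {f : X → Y} {o : FinPt X} {o' : FinPt Y}

theorem IsRegularAMMap.map_ne_infPt (hf : IsRegularAMMap f o o') {x : X} (hx : x ≠ infPt) :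
    f x ≠ infPt := by
  intro hfx
  obtain ⟨U, hU, hUV⟩ := hf.preimage_subset _
    (setOf_lt_xdist_mem_nhds_infPt ⟨x, hx⟩ (zero_lt_one : (0 : ℝ≥0) < 1))
  have hxU : f x ∈ U := hfx ▸ mem_of_mem_nhds hU
  have hlt : ((1 : ℝ≥0) : ℝ≥0∞) < xdist x x := hUV hxU
  simp [xdist_self] at hlt

/-- The restriction of a regular AM-map to a map between the metric spaces of finite points. -/
def IsRegularAMMap.finMap (hf : IsRegularAMMap f o o') (x : FinPt X) : FinPt Y :=
  ⟨f x.1, hf.map_ne_infPt x.2⟩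

theorem IsRegularAMMap.tendsto_finMap_cobounded (hf : IsRegularAMMap f o o') :
    Tendsto hf.finMap (cobounded (FinPt X)) (cobounded (FinPt Y)) := by
  rw [← FinPt.comap_val_nhds_infPt, ← FinPt.comap_val_nhds_infPt, tendsto_comap_iff]
  have hlim := hf.continuousAt.tendsto
  rw [hf.map_infPt] at hlim
  exact hlim.comp tendsto_comap

theorem IsRegularAMMap.exists_quasiSymmetricUpTo (hf : IsRegularAMMap f o o') :
    ∃ (u : ℝ≥0 → ℝ) (η : ℝ≥0 ≃ₜ ℝ≥0), IsAdmissibleGauge u ∧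
      QuasiSymmetricUpTo u η o hf.finMap := by
  obtain ⟨u, η, hu, hcross⟩ := hf.cross_ratio
  refine ⟨u, η, hu, fun a b c hbc hab hac hbc' => dist_le_mul_of_crossRatio_infPt_lt ?_⟩
  have hsep_infPt (x : FinPt X) : Separated u o x.1 infPt := Or.inr (Or.inl ⟨x.2, rfl⟩)
  have h := hcross a.1 b.1 c.1 infPt
    ⟨separated_of_gauge_lt_dist hab, separated_of_gauge_lt_dist hac, hsep_infPt a,
      separated_of_gauge_lt_dist hbc', hsep_infPt b, hsep_infPt c⟩ a.2 (Subtype.coe_ne_coe.2 hbc)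
  rwa [crossRatio_infPt hbc, ENNReal.toNNReal_coe, hf.map_infPt] at h

end ExtendedMetric

/-! ### Maps induced on asymptotic cones -/

section Gauge

variable {u : ℝ≥0 → ℝ}

theorem IsAdmissibleGauge.eventually_lt_mul (hu : IsAdmissibleGauge u) {ε : ℝ} (hε : 0 < ε) :
    ∀ᶠ t : ℝ≥0 in atTop, u t < ε * t := by
  filter_upwards [hu.sublinear.eventually_lt_const hε, eventually_gt_atTop 0] with t hut ht
  exact (div_lt_iff₀ (NNReal.coe_pos.2 ht)).1 hut

theorem IsAdmissibleGauge.eventually_comp_lt_mul (hu : IsAdmissibleGauge u) {ι : Type*}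
    {l : Filter ι} {r : ι → ℝ} (hr : Tendsto r l atTop) {t : ι → ℝ≥0} {C : ℝ}
    (ht : ∀ᶠ i in l, t i ≤ C * r i) {δ : ℝ} (hδ : 0 < δ) : ∀ᶠ i in l, u (t i) < δ * r i := by
  obtain ⟨D, hD, hCD⟩ : ∃ D : ℝ, 0 < D ∧ C ≤ D := ⟨max C 1, by positivity, le_max_left _ _⟩
  have hlim : Tendsto (fun i => (D * r i).toNNReal) l atTop :=
    tendsto_real_toNNReal_atTop.comp (hr.const_mul_atTop hD)
  filter_upwards [ht, hlim.eventually (hu.eventually_lt_mul (div_pos hδ hD)),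
    hr.eventually_gt_atTop 0] with i hti hui hri
  have htD : (t i : ℝ) ≤ D * r i := hti.trans (by gcongr)
  calc
    u (t i) ≤ u (D * r i).toNNReal := hu.monotone (NNReal.le_toNNReal_of_coe_le htD)
    _ < δ / D * (D * r i).toNNReal := hui
    _ = δ * r i := by
      rw [Real.coe_toNNReal _ (by positivity)]
      field_simp

end Gauge

theorem exists_isometry_separationQuotient_apply_mk_eq {α : Type*} [PseudoMetricSpace α] (a : α) :
    ∃ φ : SeparationQuotient α → α, Isometry φ ∧ φ (SeparationQuotient.mk a) = a := by
  classical
  let φ := Function.update (Function.surjInv SeparationQuotient.surjective_mk)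
    (SeparationQuotient.mk a) a
  have hφ (x) : SeparationQuotient.mk (φ x) = x := by
    rcases eq_or_ne x (SeparationQuotient.mk a) with rfl | hx
    · simp [φ]
    · simpa [φ, hx] using Function.surjInv_eq SeparationQuotient.surjective_mk x
  refine ⟨φ, Isometry.of_dist_eq fun x y => ?_, Function.update_self ..⟩
  rw [← SeparationQuotient.dist_mk, hφ, hφ]

section Cone

variable {M : Type u} [MetricSpace M] {q o : M} {ω : Ultrafilter ℕ} {r : ℕ → ℝ}
  {hr : Tendsto r ω atTop}

/-- The constant sequence at `o`, as a point of an asymptotic cone. -/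
def ConeSeq.const (o : M) : ConeSeq q ω r hr :=
  ⟨fun _ => o, dist q o, by
    filter_upwards [hr.eventually_ge_atTop 1] with n hn
    exact div_le_self dist_nonneg hn⟩

namespace ConeSeq

theorem exists_dist_le_mul (o : M) (x : ConeSeq q ω r hr) :
    ∃ C : ℝ, ∀ᶠ n in (ω : Filter ℕ), dist o (x.1 n) ≤ C * r n := by
  refine ⟨coneDist (const o) x + 1, ?_⟩
  filter_upwards [(tendsto_coneDist (const o) x).eventually_lt_const (lt_add_one _),
    hr.eventually_gt_atTop 0] with n hlt hrn
  exact ((div_lt_iff₀ hrn).1 hlt).le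

theorem eventually_mul_lt_dist {x y : ConeSeq q ω r hr} {δ : ℝ} (hδ : δ < dist x y) :
    ∀ᶠ n in (ω : Filter ℕ), δ * r n < dist (x.1 n) (y.1 n) := by
  filter_upwards [(tendsto_coneDist x y).eventually_const_lt hδ, hr.eventually_gt_atTop 0]
    with n hlt hrn
  exact (lt_div_iff₀ hrn).1 hlt

theorem eventually_ne {x y : ConeSeq q ω r hr} (hxy : 0 < dist x y) :
    ∀ᶠ n in (ω : Filter ℕ), x.1 n ≠ y.1 n := by
  filter_upwards [eventually_mul_lt_dist hxy] with n hn
  simpa using hn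

theorem eventually_gauge_lt_dist (o : M) {u : ℝ≥0 → ℝ} (hu : IsAdmissibleGauge u)
    {x y : ConeSeq q ω r hr} (hxy : 0 < dist x y) :
    ∀ᶠ n in (ω : Filter ℕ),
      u (nndist o (x.1 n) + nndist o (y.1 n)) < dist (x.1 n) (y.1 n) := by
  obtain ⟨C, hC⟩ := x.exists_dist_le_mul o
  obtain ⟨D, hD⟩ := y.exists_dist_le_mul o
  have hsum : ∀ᶠ n in (ω : Filter ℕ),
      ((nndist o (x.1 n) + nndist o (y.1 n) : ℝ≥0) : ℝ) ≤ (C + D) * r n := by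
    filter_upwards [hC, hD] with n hCn hDn
    rw [NNReal.coe_add, add_mul]
    exact add_le_add hCn hDn
  filter_upwards [hu.eventually_comp_lt_mul hr hsum (half_pos hxy),
    eventually_mul_lt_dist (half_lt_self hxy)] with n hun hdist
  exact hun.trans hdist

theorem tendsto_cobounded {x : ConeSeq q ω r hr} (hx : 0 < dist x (const o)) :
    Tendsto x.1 ω (cobounded M) := by
  rw [← Metric.comap_dist_right_atTop o, tendsto_comap_iff]
  refine tendsto_atTop_mono' _ ?_ (hr.const_mul_atTop (half_pos hx))
  filter_upwards [eventually_mul_lt_dist (half_lt_self hx)] with n hn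
  exact hn.le

theorem tendsto_nndist_div (x : ConeSeq q ω r hr) {y z : ConeSeq q ω r hr} (hyz : 0 < dist y z) :
    Tendsto (fun n => nndist (x.1 n) (z.1 n) / nndist (y.1 n) (z.1 n)) ω
      (𝓝 (nndist x z / nndist y z)) := by
  rw [← NNReal.tendsto_coe]
  refine ((tendsto_coneDist x z).div (tendsto_coneDist y z) hyz.ne').congr' ?_
  filter_upwards [hr.eventually_gt_atTop 0] with n hrn
  exact div_div_div_cancel_right₀ hrn.ne' _ _

end ConeSeq

variable {N : Type v} [MetricSpace N] {g : M → N} {u : ℝ≥0 → ℝ} {η : ℝ≥0 → ℝ≥0}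

namespace QuasiSymmetricUpTo

theorem eventually_dist_map_le (hg : QuasiSymmetricUpTo u η o g) (hu : IsAdmissibleGauge u)
    {x y z : ConeSeq q ω r hr} (hxy : 0 < dist x y) (hxz : 0 < dist x z) (hyz : 0 < dist y z) :
    ∀ᶠ n in (ω : Filter ℕ), dist (g (x.1 n)) (g (z.1 n)) ≤
      η (nndist (x.1 n) (z.1 n) / nndist (y.1 n) (z.1 n)) * dist (g (y.1 n)) (g (z.1 n)) := by
  filter_upwards [ConeSeq.eventually_ne hyz, ConeSeq.eventually_gauge_lt_dist o hu hxy,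
    ConeSeq.eventually_gauge_lt_dist o hu hxz, ConeSeq.eventually_gauge_lt_dist o hu hyz]
    with n hne hxyn hxzn hyzn
  exact hg _ _ _ hne hxyn hxzn hyzn

section Isometry

variable {T : Type*} [MetricSpace T] {φ : T → ConeSeq q ω r hr}

theorem exists_dist_map_le_mul (hg : QuasiSymmetricUpTo u η o g) (hu : IsAdmissibleGauge u)
    (hη : Continuous η) (hφ : Isometry φ) (x : T) {y z : T} (hyz : y ≠ z) :
    ∃ C : ℝ, ∀ᶠ n in (ω : Filter ℕ),
      dist (g ((φ x).1 n)) (g ((φ z).1 n)) ≤ C * dist (g ((φ y).1 n)) (g ((φ z).1 n)) := by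
  have hpos {a b : T} (hab : a ≠ b) : 0 < dist (φ a) (φ b) := by rwa [hφ.dist_eq, dist_pos]
  rcases eq_or_ne x z with rfl | hxz
  · exact ⟨0, by simp⟩
  rcases eq_or_ne x y with rfl | hxy
  · exact ⟨1, by simp⟩
  have hlim := (hη.tendsto _).comp (ConeSeq.tendsto_nndist_div (φ x) (hpos hyz))
  refine ⟨(η (nndist (φ x) (φ z) / nndist (φ y) (φ z)) + 1 : ℝ≥0), ?_⟩
  filter_upwards [hg.eventually_dist_map_le hu (hpos hxy) (hpos hxz) (hpos hyz),
    hlim.eventually_lt_const (lt_add_one _)] with n hle hlt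
  exact hle.trans (mul_le_mul_of_nonneg_right (NNReal.coe_le_coe.2 hlt.le) dist_nonneg)

theorem quasiSymmetric_mk_comp (hg : QuasiSymmetricUpTo u η o g) (hu : IsAdmissibleGauge u)
    (hη : Continuous η) (hφ : Isometry φ) {q' : N} {s : ℕ → ℝ} {hs : Tendsto s ω atTop}
    {ψ : T → ConeSeq q' ω s hs} (hψ : ∀ x n, (ψ x).1 n = g ((φ x).1 n)) :
    QuasiSymmetric η (SeparationQuotient.mk ∘ ψ) := by
  have hpos {a b : T} (hab : a ≠ b) : 0 < dist (φ a) (φ b) := by rwa [hφ.dist_eq, dist_pos]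
  intro x y z hxy hyz
  rcases eq_or_ne x z with rfl | hxz
  · rw [dist_self]
    positivity
  have hlim := NNReal.tendsto_coe.2
    ((hη.tendsto _).comp (ConeSeq.tendsto_nndist_div (φ x) (hpos hyz)))
  rw [hφ.nndist_eq, hφ.nndist_eq] at hlim
  simp only [Function.comp_apply, SeparationQuotient.dist_mk]
  refine le_of_tendsto_of_tendsto (tendsto_coneDist (ψ x) (ψ z))
    (hlim.mul (tendsto_coneDist (ψ y) (ψ z))) ?_
  filter_upwards [hg.eventually_dist_map_le hu (hpos hxy) (hpos hxz) (hpos hyz),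
    hs.eventually_gt_atTop 0] with n hle hsn
  rw [hψ, hψ, hψ, ← mul_div_assoc]
  exact div_le_div_of_nonneg_right hle hsn.le

end Isometry

theorem exists_quasiSymmetric_cone (hg : QuasiSymmetricUpTo u η o g) (hu : IsAdmissibleGauge u)
    (hη : Continuous η) (hgo : Tendsto g (cobounded M) (cobounded N))
    [Nontrivial (SeparationQuotient (ConeSeq q ω r hr))] :
    ∃ (s : ℕ → ℝ) (hs : Tendsto s ω atTop)
      (F : SeparationQuotient (ConeSeq q ω r hr) → SeparationQuotient (ConeSeq (g o) ω s hs)),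
      QuasiSymmetric η F ∧ ∃ x y, F x ≠ F y := by
  -- Nothing controls the distance of the images of two sequences that represent the same point of
  -- the cone, so `F` depends on a choice of representatives.
  obtain ⟨φ, hφ, hφo⟩ := exists_isometry_separationQuotient_apply_mk_eq
    (ConeSeq.const o : ConeSeq q ω r hr)
  set O : SeparationQuotient (ConeSeq q ω r hr) := SeparationQuotient.mk (ConeSeq.const o)
  have hO (n) : (φ O).1 n = o := congrArg (fun x => x.1 n) hφo
  obtain ⟨p, hp⟩ := exists_ne O
  have hp_pos : 0 < dist (φ p) (ConeSeq.const o) := by rwa [← hφo, hφ.dist_eq, dist_pos]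
  let s (n : ℕ) : ℝ := dist (g o) (g ((φ p).1 n))
  have hs : Tendsto s ω atTop := (Metric.tendsto_dist_left_cobounded_atTop (g o)).comp
    (hgo.comp (ConeSeq.tendsto_cobounded hp_pos))
  have hbdd (x) : ∃ C : ℝ, ∀ᶠ n in (ω : Filter ℕ), dist (g o) (g ((φ x).1 n)) / s n ≤ C := by
    obtain ⟨C, hC⟩ := hg.exists_dist_map_le_mul hu hη hφ x hp
    refine ⟨C, ?_⟩
    filter_upwards [hC, hs.eventually_gt_atTop 0] with n hCn hsn
    rw [hO, dist_comm, dist_comm _ (g o)] at hCn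
    exact (div_le_iff₀ hsn).2 hCn
  let ψ (x) : ConeSeq (g o) ω s hs := ⟨fun n => g ((φ x).1 n), hbdd x⟩
  have hone : dist (ψ O) (ψ p) = 1 := by
    refine tendsto_nhds_unique (tendsto_coneDist (ψ O) (ψ p)) (tendsto_const_nhds.congr' ?_)
    filter_upwards [hs.eventually_gt_atTop 0] with n hsn
    simp only [ψ, hO]
    exact (div_self hsn.ne').symm
  refine ⟨s, hs, SeparationQuotient.mk ∘ ψ,
    hg.quasiSymmetric_mk_comp hu hη hφ fun _ _ => rfl, O, p, ?_⟩
  rw [← dist_pos, Function.comp_apply, Function.comp_apply, SeparationQuotient.dist_mk, hone]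
  exact one_pos

theorem exists_continuous_injective_cone (hg : QuasiSymmetricUpTo u η o g)
    (hu : IsAdmissibleGauge u) (hη : Continuous η) (hη0 : η 0 = 0)
    (hgo : Tendsto g (cobounded M) (cobounded N)) :
    ∃ (s : ℕ → ℝ) (hs : Tendsto s ω atTop)
      (F : SeparationQuotient (ConeSeq q ω r hr) → SeparationQuotient (ConeSeq (g o) ω s hs)),
      Continuous F ∧ Function.Injective F := by
  rcases subsingleton_or_nontrivial (SeparationQuotient (ConeSeq q ω r hr)) with _ | _
  · exact ⟨r, hr, fun _ => SeparationQuotient.mk (ConeSeq.const (g o)), continuous_const,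
      Function.injective_of_subsingleton _⟩
  · obtain ⟨s, hs, F, hF, x, y, hxy⟩ := hg.exists_quasiSymmetric_cone (q := q) (hr := hr) hu hη hgo
    exact ⟨s, hs, F, hF.continuous (hη.tendsto' 0 0 hη0), hF.injective hxy⟩

end QuasiSymmetricUpTo

end Cone

theorem mainTheorem3_general {X : Type u} {Y : Type v} [ExtendedMetricSpace X]
    [ExtendedMetricSpace Y] {o : FinPt X} {o' : FinPt Y} {f : X → Y}
    (hf : IsRegularAMMap f o o') : teleDim X ≤ teleDim Y := by
  obtain ⟨u, η, hu, hqs⟩ := hf.exists_quasiSymmetricUpTo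
  simp only [teleDim, iSup_le_iff]
  intro q ω hω r hr
  obtain ⟨s, hs, F, hF, hinj⟩ := hqs.exists_continuous_injective_cone (q := q) (hr := hr)
    hu η.continuous (homeomorph_map_bot η) hf.tendsto_finMap_cobounded
  exact (geomDim_le_of_continuous_of_injective hF hinj).trans
    (geomDim_asymptoticCone_le_teleDim (hf.finMap o) hω hs)

theorem mainTheorem3 {X : Type u} {Y : Type v} [ExtendedMetricSpace X] [ExtendedMetricSpace Y]
    (o : FinPt X) (o' : FinPt Y)
    (hchain : AsymptoticallyChained o)
    (hX : AllAsymptoticConesCAT0 X) (hY : AllAsymptoticConesCAT0 Y)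
    (f : X → Y) (hf : IsRegularAMMap f o o') :
    teleDim X ≤ teleDim Y :=
  mainTheorem3_general hf
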